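/- Let $K=\mathbb{Q}(p,q,r,s)$ be the field of rational functions in four indeterminates over $\mathbb{Q}$. For elements $p,q,r,s$ of a field of characteristic zero, let $E_{p,q,r,s}$ denote the curve $$y^2=x^3-3(pqrs)^2x+2(pqrs)^3+\tfrac14\,(p^6+s^6-q^6-r^6)^2-(p^3s^3+q^3r^3)^2,$$ and put $$P_1=\Bigl(p^2q^2+r^2s^2,\tfrac{p^6+q^6-r^6-s^6}{2}\Bigr),\quad P_2=\Bigl(p^2r^2+q^2s^2,\tfrac{p^6-q^6+r^6-s^6}{2}\Bigr),\quad P_3=\Bigl(p^2s^2+q^2r^2,\tfrac{p^6-q^6-r^6+s^6}{2}\Bigr).$$ (a) For the indeterminates $p,q,r,s$ of $K$, the curve $E_{p,q,r,s}$ is an elliptic curve over $K$, the points $P_1,P_2,P_3$ lie on it, and they are linearly independent over $\mathbb{Z}$ in the group $E_{p,q,r,s}(K)$. In particular, $E_{p,q,r,s}(K)$ has rank at least three. (b) For $(p,q,r,s)=(1,\tfrac12,2,0)$ the curve is the elliptic curve $y^2=x^3+\tfrac{16248705}{16384}$ over $\mathbb{Q}$, and the points $P_1,P_2,P_3$ are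 linearly independent over $\mathbb{Z}$ in its group of rational points. -/

import Mathlib

/-- The curve `y² = x³ - 3(pqrs)²x + 2(pqrs)³ + (p⁶ + s⁶ - q⁶ - r⁶)²/4 - (p³s³ + q³r³)²`
attached to elements `p, q, r, s` of a field. -/
def brahmaguptaCurve {F : Type*} [Field F] (p q r s : F) : WeierstrassCurve.Affine F where
  a₁ := 0
  a₂ := 0
  a₃ := 0
  a₄ := -3 * (p * q * r * s) ^ 2
  a₆ := 2 * (p * q * r * s) ^ 3 + (1 / 4) * (p ^ 6 + s ^ 6 - q ^ 6 - r ^ 6) ^ 2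
    - (p ^ 3 * s ^ 3 + q ^ 3 * r ^ 3) ^ 2

/-- The `x`-coordinates of the points `P₁, P₂, P₃`. -/
def brahmaguptaX {F : Type*} [Field F] (p q r s : F) : Fin 3 → F :=
  ![p ^ 2 * q ^ 2 + r ^ 2 * s ^ 2,
    p ^ 2 * r ^ 2 + q ^ 2 * s ^ 2,
    p ^ 2 * s ^ 2 + q ^ 2 * r ^ 2]

/-- The `y`-coordinates of the points `P₁, P₂, P₃`. -/
def brahmaguptaY {F : Type*} [Field F] (p q r s : F) : Fin 3 → F :=
  ![(p ^ 6 + q ^ 6 - r ^ 6 - s ^ 6) / 2,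
    (p ^ 6 - q ^ 6 + r ^ 6 - s ^ 6) / 2,
    (p ^ 6 - q ^ 6 - r ^ 6 + s ^ 6) / 2]

open Classical in
/-- All three pairs `(xᵢ, yᵢ)` are (nonsingular) points of the curve over `F`, and the three points
`P₁, P₂, P₃` are linearly independent over `ℤ` in the group of `F`-points of the curve. -/
def BrahmaguptaPointsIndependent {F : Type*} [Field F] (p q r s : F) : Prop :=
  ∃ h : ∀ i, (brahmaguptaCurve p q r s).Nonsingular (brahmaguptaX p q r s i)
      (brahmaguptaY p q r s i),
    LinearIndependent ℤ fun i : Fin 3 =>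
      (WeierstrassCurve.Affine.Point.some _ _ (h i) : (brahmaguptaCurve p q r s).Point)

open Classical in
/-- The Mordell-Weil rank of a Weierstrass curve over a field: the rank of its group of points as a
`ℤ`-module, as a cardinal number. -/
noncomputable def mordellWeilRank {F : Type*} [Field F] (W : WeierstrassCurve.Affine F) :
    Cardinal :=
  Module.rank ℤ W.Point

/-- The field `ℚ(p, q, r, s)` of rational functions in four indeterminates over `ℚ`. -/
abbrev RatFunc4 : Type := FractionRing (MvPolynomial (Fin 4) ℚ)

/-- The four indeterminates `p, q, r, s`, as elements of `ℚ(p, q, r, s)`. -/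
noncomputable def indet (i : Fin 4) : RatFunc4 :=
  algebraMap (MvPolynomial (Fin 4) ℚ) RatFunc4 (MvPolynomial.X i)

/-!
Independence is proved by a 2-descent that uses only the doubling formula. If an abelian group has
no 2-torsion and none of the seven sums `∑ i ∈ S, P i` (`S ≠ ∅`) is a double, then the `P i` are
linearly independent over `ℤ`: a relation has even coefficients, halving it gives another relation,
so every coefficient is divisible by every power of two
(`linearIndependent_int_of_forall_ne_two_nsmul`).

On `y² = x³ + a x + b` a point with abscissa `X` is the double of a point with abscissa `t` only if
`t⁴ - 4X t³ - 2a t² - (4aX + 8b) t + a² - 4bX = 0`, and a point of order two has an abscissa with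
`t³ + a t + b = 0`. Both equations are monic, which allows the generic curve to be specialized
without a reduction map on its group of points: let `A` be the local ring of
`ℚ[p, q, r, s]` at `(1, 1/2, 2, 0)`. It is integrally closed with fraction field `ℚ(p, q, r, s)`.
When `a`, `b`, `X` lie in `A`, so does any root `t`, and its value at `(1, 1/2, 2, 0)` is a rational
root of the specialized equation (`exists_root_of_eq_two_nsmul`, `exists_root_of_two_nsmul_eq_zero`).
The specialized points `P₁`, `P₂`, `P₃` have different abscissas `1/4`, `4`, `1`, and that of
`P₁ + P₂` differs from the abscissa of `P₃`, so the sums of points specialize by the chord formula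
(`PointReduces.add`). It remains to see that one cubic and seven quartics over `ℚ` have no rational
root: the cubic is `t³ + 16248705 / 2¹⁴`, which has none because `3 ∤ 14`, and the quartics have no
root modulo `7` or, for `P₁ + P₂ + P₃`, modulo `29`.

The specialized curve itself is the case `A = ℚ` of the same argument.
-/

/-! ### Linear independence from indivisibility by two -/

theorem linearIndependent_int_of_forall_ne_two_nsmul {ι G : Type*} [Fintype ι] [AddCommGroup G]
    (P : ι → G) (htor : ∀ Q : G, 2 • Q = 0 → Q = 0)
    (hdiv : ∀ S : Finset ι, S.Nonempty → ∀ Q : G, ∑ i ∈ S, P i ≠ 2 • Q) :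
    LinearIndependent ℤ P := by
  classical
  have key : ∀ n : ℕ, ∀ g : ι → ℤ, ∑ i, g i • P i = 0 → ∀ i, (2 : ℤ) ^ n ∣ g i := by
    intro n
    induction n with
    | zero => intro g _ i; simp
    | succ n ih =>
      intro g hg
      have hsplit : (∑ i ∈ Finset.univ.filter (fun i => g i % 2 = 1), P i)
          + 2 • ∑ i, (g i / 2) • P i = 0 := by
        rw [← hg, Finset.sum_filter, Finset.smul_sum, ← Finset.sum_add_distrib]
        refine Finset.sum_congr rfl fun i _ => ?_
        have h2 : 2 • (g i / 2) • P i = (2 * (g i / 2)) • P i := by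
          rw [mul_smul, ofNat_zsmul]
        conv_rhs => rw [← Int.emod_add_mul_ediv (g i) 2, add_smul]
        rw [h2]
        rcases Int.emod_two_eq_zero_or_one (g i) with h | h <;> simp [h]
      have hempty : Finset.univ.filter (fun i => g i % 2 = 1) = ∅ := by
        by_contra hne
        refine hdiv _ (Finset.nonempty_iff_ne_empty.mpr hne) (-∑ i, (g i / 2) • P i) ?_
        rw [smul_neg, eq_neg_iff_add_eq_zero, hsplit]
      rw [hempty, Finset.sum_empty, zero_add] at hsplit
      intro i
      have hi : g i % 2 = 0 := by
        have := Finset.eq_empty_iff_forall_notMem.mp hempty i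
        simp only [Finset.mem_filter, Finset.mem_univ, true_and] at this
        omega
      have := ih _ (htor _ hsplit) i
      rw [pow_succ, ← Int.ediv_mul_cancel (Int.dvd_of_emod_eq_zero hi)]
      exact mul_dvd_mul_right this 2
  rw [Fintype.linearIndependent_iff]
  intro g hg i
  by_contra h0
  have hle := Int.le_of_dvd (abs_pos.mpr h0) ((dvd_abs _ _).mpr (key (g i).natAbs g hg i))
  have hlt : ((g i).natAbs : ℤ) < 2 ^ (g i).natAbs := by exact_mod_cast Nat.lt_two_pow_self
  rw [Int.natCast_natAbs] at hlt
  omega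

/-! ### Specialization of elements of a fraction field -/

/-- The element `x` of the `A`-algebra `K` comes from an element of `A` whose image under
`φ : A →+* F` is `ξ`. -/
def Reduces {A K F : Type*} [CommRing A] [Field K] [Algebra A K] [Field F] (φ : A →+* F)
    (x : K) (ξ : F) : Prop :=
  ∃ a : A, algebraMap A K a = x ∧ φ a = ξ

namespace Reduces

variable {A K F : Type*} [CommRing A] [Field K] [Algebra A K] [Field F] {φ : A →+* F}
  {x y : K} {ξ η : F}

theorem add (hx : Reduces φ x ξ) (hy : Reduces φ y η) : Reduces φ (x + y) (ξ + η) := by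
  obtain ⟨a, rfl, rfl⟩ := hx
  obtain ⟨b, rfl, rfl⟩ := hy
  exact ⟨a + b, map_add .., map_add ..⟩

theorem sub (hx : Reduces φ x ξ) (hy : Reduces φ y η) : Reduces φ (x - y) (ξ - η) := by
  obtain ⟨a, rfl, rfl⟩ := hx
  obtain ⟨b, rfl, rfl⟩ := hy
  exact ⟨a - b, map_sub .., map_sub ..⟩

theorem mul (hx : Reduces φ x ξ) (hy : Reduces φ y η) : Reduces φ (x * y) (ξ * η) := by
  obtain ⟨a, rfl, rfl⟩ := hx
  obtain ⟨b, rfl, rfl⟩ := hy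
  exact ⟨a * b, map_mul .., map_mul ..⟩

theorem neg (hx : Reduces φ x ξ) : Reduces φ (-x) (-ξ) := by
  obtain ⟨a, rfl, rfl⟩ := hx
  exact ⟨-a, map_neg .., map_neg ..⟩

theorem pow (hx : Reduces φ x ξ) (n : ℕ) : Reduces φ (x ^ n) (ξ ^ n) := by
  obtain ⟨a, rfl, rfl⟩ := hx
  exact ⟨a ^ n, map_pow .., map_pow ..⟩

variable (φ) in
theorem one : Reduces φ (1 : K) 1 := ⟨1, map_one _, map_one _⟩

variable (φ) in
theorem ofNat (n : ℕ) [n.AtLeastTwo] : Reduces φ (OfNat.ofNat n : K) (OfNat.ofNat n) :=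
  ⟨OfNat.ofNat n, map_ofNat .., map_ofNat ..⟩

theorem div [IsLocalHom φ] (hx : Reduces φ x ξ) (hy : Reduces φ y η) (hη : η ≠ 0) :
    Reduces φ (x / y) (ξ / η) := by
  obtain ⟨a, rfl, rfl⟩ := hx
  obtain ⟨b, rfl, rfl⟩ := hy
  -- locality of `φ` makes the denominator a unit of `A`
  obtain ⟨u, rfl⟩ := isUnit_of_map_unit φ b (isUnit_iff_ne_zero.mpr hη)
  refine ⟨a * ↑u⁻¹, ?_, ?_⟩
  · rw [map_mul, div_eq_mul_inv, map_units_inv]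
  · rw [map_mul, div_eq_mul_inv, map_units_inv]

theorem congr (hx : Reduces φ x ξ) (hy : y = x) (hη : ξ = η) : Reduces φ y η :=
  hy ▸ hη ▸ hx

section IsFractionRing

variable [IsFractionRing A K]

theorem unique {ξ' : F} (h : Reduces φ x ξ) (h' : Reduces φ x ξ') : ξ = ξ' := by
  obtain ⟨a, rfl, rfl⟩ := h
  obtain ⟨b, hb, rfl⟩ := h'
  rw [IsFractionRing.injective A K hb]

theorem ne (hx : Reduces φ x ξ) (hy : Reduces φ y η) (h : ξ ≠ η) : x ≠ y := by
  rintro rfl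
  exact h (hx.unique hy)

theorem of_isIntegral [IsDomain A] [IsIntegrallyClosed A] (φ : A →+* F) (h : IsIntegral A x) :
    ∃ ξ, Reduces φ x ξ := by
  obtain ⟨a, ha⟩ := IsIntegrallyClosed.algebraMap_eq_of_integral h
  exact ⟨φ a, a, ha, rfl⟩

/-- A root in `K` of a monic quartic over an integrally closed `A` specializes to a root of the
specialized quartic. -/
theorem exists_quartic_root [IsDomain A] [IsIntegrallyClosed A] {t c₃ c₂ c₁ c₀ : K}
    {γ₃ γ₂ γ₁ γ₀ : F} (h₃ : Reduces φ c₃ γ₃) (h₂ : Reduces φ c₂ γ₂) (h₁ : Reduces φ c₁ γ₁)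
    (h₀ : Reduces φ c₀ γ₀) (ht : t ^ 4 + c₃ * t ^ 3 + c₂ * t ^ 2 + c₁ * t + c₀ = 0) :
    ∃ τ : F, τ ^ 4 + γ₃ * τ ^ 3 + γ₂ * τ ^ 2 + γ₁ * τ + γ₀ = 0 := by
  have hint : IsIntegral A t := by
    obtain ⟨a₃, rfl, -⟩ := h₃
    obtain ⟨a₂, rfl, -⟩ := h₂
    obtain ⟨a₁, rfl, -⟩ := h₁
    obtain ⟨a₀, rfl, -⟩ := h₀
    refine ⟨.X ^ 4 + .C a₃ * .X ^ 3 + .C a₂ * .X ^ 2 + .C a₁ * .X + .C a₀, by monicity!, ?_⟩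
    simpa using ht
  obtain ⟨τ, hτ⟩ := of_isIntegral φ hint
  have := ((((hτ.pow 4).add (h₃.mul (hτ.pow 3))).add (h₂.mul (hτ.pow 2))).add (h₁.mul hτ)).add h₀
  rw [ht] at this
  exact ⟨τ, this.unique ⟨0, map_zero _, map_zero _⟩⟩

end IsFractionRing

end Reduces

/-! ### Specialization of points on short Weierstrass curves -/

section Points

variable {A K F : Type*} [CommRing A] [Field K] [Algebra A K] [Field F] {φ : A →+* F}
  {W : WeierstrassCurve.Affine K} {α β : F}

/-- The point `P` is affine, and its coordinates specialize to `ξ` and `η`. -/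
def PointReduces (φ : A →+* F) (P : W.Point) (ξ η : F) : Prop :=
  ∃ (x y : K) (h : W.Nonsingular x y), P = .some x y h ∧ Reduces φ x ξ ∧ Reduces φ y η

open Classical in
/-- If the abscissas of two points have different specializations, the chord through the points
specializes, and with it their sum. -/
theorem PointReduces.add [IsFractionRing A K] [IsLocalHom φ] (h₁ : W.a₁ = 0) (h₂ : W.a₂ = 0)
    (h₃ : W.a₃ = 0) {P Q : W.Point} {ξ₁ η₁ ξ₂ η₂ : F} (hP : PointReduces φ P ξ₁ η₁)
    (hQ : PointReduces φ Q ξ₂ η₂) (hne : ξ₁ ≠ ξ₂) {ℓ ξ η : F} (hℓ : (η₁ - η₂) / (ξ₁ - ξ₂) = ℓ)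
    (hξ : ℓ ^ 2 - ξ₁ - ξ₂ = ξ) (hη : -(ℓ * (ξ - ξ₁) + η₁) = η) :
    PointReduces φ (P + Q) ξ η := by
  obtain ⟨x₁, y₁, hns₁, rfl, hx₁, hy₁⟩ := hP
  obtain ⟨x₂, y₂, hns₂, rfl, hx₂, hy₂⟩ := hQ
  have hx : x₁ ≠ x₂ := hx₁.ne hx₂ hne
  have hs : Reduces φ (W.slope x₁ x₂ y₁ y₂) ℓ := by
    rw [WeierstrassCurve.Affine.slope_of_X_ne hx, ← hℓ]
    exact (hy₁.sub hy₂).div (hx₁.sub hx₂) (sub_ne_zero.mpr hne)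
  have hX : Reduces φ (W.addX x₁ x₂ (W.slope x₁ x₂ y₁ y₂)) ξ := by
    simp only [WeierstrassCurve.Affine.addX, h₁, h₂, zero_mul, add_zero, sub_zero]
    exact hξ ▸ ((hs.pow 2).sub hx₁).sub hx₂
  refine ⟨_, _, _, WeierstrassCurve.Affine.Point.add_of_X_ne hx, hX, ?_⟩
  simp only [WeierstrassCurve.Affine.addY, WeierstrassCurve.Affine.negAddY,
    WeierstrassCurve.Affine.negY, h₁, h₃, zero_mul, sub_zero]
  exact hη ▸ ((hs.mul (hX.sub hx₁)).add hy₁).neg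

open Classical in
/-- A point of order two has ordinate zero, so its abscissa is integral over `A`. -/
theorem exists_root_of_two_nsmul_eq_zero [IsFractionRing A K] [IsDomain A] [IsIntegrallyClosed A]
    [CharZero K] (h₁ : W.a₁ = 0) (h₂ : W.a₂ = 0) (h₃ : W.a₃ = 0) (h₄ : Reduces φ W.a₄ α)
    (h₆ : Reduces φ W.a₆ β) {Q : W.Point} (hQ : Q ≠ 0) (h : 2 • Q = 0) :
    ∃ τ : F, τ ^ 3 + α * τ + β = 0 := by
  rcases Q with _ | ⟨x, y, hq⟩
  · exact absurd WeierstrassCurve.Affine.Point.zero_def hQ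
  have hE := (WeierstrassCurve.Affine.equation_iff ..).mp hq.1
  simp only [h₁, h₂, h₃, zero_mul, add_zero] at hE
  rw [two_nsmul] at h
  by_cases hy : y = W.negY x y
  swap
  · rw [WeierstrassCurve.Affine.Point.add_self_of_Y_ne hy] at h
    exact absurd h (WeierstrassCurve.Affine.Point.some_ne_zero _)
  simp only [WeierstrassCurve.Affine.negY, h₁, h₃, zero_mul, sub_zero] at hy
  obtain rfl : y = 0 := self_eq_neg.mp hy
  have hx : x ^ 3 + W.a₄ * x + W.a₆ = 0 := by linear_combination -hE
  have hint : IsIntegral A x := by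
    obtain ⟨a, ha, -⟩ := h₄
    obtain ⟨b, hb, -⟩ := h₆
    refine ⟨.X ^ 3 + .C a * .X + .C b, by monicity!, ?_⟩
    simpa [ha, hb] using hx
  obtain ⟨τ, hτ⟩ := Reduces.of_isIntegral φ hint
  have := ((hτ.pow 3).add (h₄.mul hτ)).add h₆
  rw [hx] at this
  exact ⟨τ, this.unique ⟨0, map_zero _, map_zero _⟩⟩

open Classical in
/-- The doubling formula is a quartic equation for the abscissa of `Q`. It is monic after clearing
the denominator `4 y² = 4 (x³ + a₄ x + a₆)`, hence specializes. -/
theorem exists_root_of_eq_two_nsmul [IsFractionRing A K] [IsDomain A] [IsIntegrallyClosed A]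
    (h₁ : W.a₁ = 0) (h₂ : W.a₂ = 0) (h₃ : W.a₃ = 0) (h₄ : Reduces φ W.a₄ α)
    (h₆ : Reduces φ W.a₆ β) {P Q : W.Point} {ξ η : F} (hP : PointReduces φ P ξ η)
    (h : P = 2 • Q) :
    ∃ τ : F, τ ^ 4 + -(4 * ξ) * τ ^ 3 + -(2 * α) * τ ^ 2 + -(4 * α * ξ + 8 * β) * τ
      + (α ^ 2 - 4 * β * ξ) = 0 := by
  obtain ⟨X, Y, hns, rfl, hX, -⟩ := hP
  rcases Q with _ | ⟨x, y, hq⟩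
  · rw [← WeierstrassCurve.Affine.Point.zero_def, smul_zero] at h
    exact absurd h (WeierstrassCurve.Affine.Point.some_ne_zero _)
  have hE := (WeierstrassCurve.Affine.equation_iff ..).mp hq.1
  simp only [h₁, h₂, h₃, zero_mul, add_zero] at hE
  rw [two_nsmul] at h
  by_cases hy : y = W.negY x y
  · rw [WeierstrassCurve.Affine.Point.add_self_of_Y_eq hy] at h
    exact absurd h (WeierstrassCurve.Affine.Point.some_ne_zero _)
  rw [WeierstrassCurve.Affine.Point.add_self_of_Y_ne hy] at h
  obtain ⟨hXX, -⟩ := WeierstrassCurve.Affine.Point.some.inj h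
  rw [WeierstrassCurve.Affine.slope_of_Y_ne rfl hy] at hXX
  simp only [WeierstrassCurve.Affine.addX, WeierstrassCurve.Affine.negY, h₁, h₂, h₃, zero_mul,
    mul_zero, add_zero, sub_zero] at hXX hy
  have h2y : y - -y ≠ 0 := sub_ne_zero.mpr hy
  refine Reduces.exists_quartic_root (((Reduces.ofNat φ 4).mul hX).neg)
    (((Reduces.ofNat φ 2).mul h₄).neg)
    (((((Reduces.ofNat φ 4).mul h₄).mul hX).add ((Reduces.ofNat φ 8).mul h₆)).neg)
    ((h₄.pow 2).sub (((Reduces.ofNat φ 4).mul h₆).mul hX)) (t := x) ?_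
  rw [div_pow, eq_sub_iff_add_eq, eq_sub_iff_add_eq, eq_div_iff (pow_ne_zero 2 h2y)] at hXX
  linear_combination (4 * (X + 2 * x)) * hE - hXX

end Points

/-! ### Polynomials without rational roots -/

/-- A root `τ`, written in lowest terms, gives a zero of the homogenized quartic modulo `ℓ`. Since
the leading coefficient is invertible modulo `ℓ`, so is the denominator of `τ`. -/
theorem quartic_ne_zero_of_zmod {ℓ : ℕ} (hℓ : ℓ.Prime) (c₄ c₃ c₂ c₁ c₀ : ℤ)
    (h₄ : (c₄ : ZMod ℓ) ≠ 0)
    (h : ∀ t : ZMod ℓ, c₄ * t ^ 4 + c₃ * t ^ 3 + c₂ * t ^ 2 + c₁ * t + c₀ ≠ 0) (τ : ℚ) :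
    c₄ * τ ^ 4 + c₃ * τ ^ 3 + c₂ * τ ^ 2 + c₁ * τ + c₀ ≠ 0 := by
  have : Fact ℓ.Prime := ⟨hℓ⟩
  intro h0
  have hden : (τ.den : ℚ) ≠ 0 := by exact_mod_cast τ.den_nz
  have hZ : c₄ * τ.num ^ 4 + c₃ * τ.num ^ 3 * τ.den + c₂ * τ.num ^ 2 * τ.den ^ 2
      + c₁ * τ.num * τ.den ^ 3 + c₀ * τ.den ^ 4 = 0 := by
    rw [← Rat.num_div_den τ] at h0
    field_simp at h0
    have : ((c₄ * τ.num ^ 4 + c₃ * τ.num ^ 3 * τ.den + c₂ * τ.num ^ 2 * τ.den ^ 2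
      + c₁ * τ.num * τ.den ^ 3 + c₀ * τ.den ^ 4 : ℤ) : ℚ) = 0 := by
      push_cast
      linear_combination h0
    exact_mod_cast this
  have hM := congrArg (Int.cast : ℤ → ZMod ℓ) hZ
  push_cast at hM
  by_cases hd : (τ.den : ZMod ℓ) = 0
  · rw [hd] at hM
    have hn : (τ.num : ZMod ℓ) = 0 := by simpa [h₄] using hM
    have h1 : ℓ ∣ τ.den := (ZMod.natCast_eq_zero_iff _ _).mp hd
    have h2 : ℓ ∣ τ.num.natAbs := by
      rw [← Int.natCast_dvd]
      exact (ZMod.intCast_zmod_eq_zero_iff_dvd _ _).mp hn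
    exact hℓ.one_lt.ne' (Nat.dvd_one.mp (τ.reduced ▸ Nat.dvd_gcd h2 h1))
  · refine h (τ.num / τ.den) ?_
    field_simp
    linear_combination hM

theorem pow_three_ne_of_not_three_dvd (ℓ : ℕ) [Fact ℓ.Prime] {a : ℚ}
    (h : ¬ (3 : ℤ) ∣ padicValRat ℓ a) (τ : ℚ) : τ ^ 3 ≠ a := by
  rintro rfl
  rw [padicValRat.pow] at h
  exact h (dvd_mul_right _ _)

/-! ### The three points -/

theorem forall_nonempty_sum_fin_three {G : Type*} [AddCommMonoid G] (P : Fin 3 → G)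
    {p : G → Prop} (h₀ : p (P 0)) (h₁ : p (P 1)) (h₂ : p (P 2)) (h₀₁ : p (P 0 + P 1))
    (h₀₂ : p (P 0 + P 2)) (h₁₂ : p (P 1 + P 2)) (h₀₁₂ : p (P 0 + P 1 + P 2)) (S : Finset (Fin 3))
    (hS : S.Nonempty) : p (∑ i ∈ S, P i) := by
  have hcases : ∀ S : Finset (Fin 3), S.Nonempty → S = {0} ∨ S = {1} ∨ S = {2} ∨ S = {0, 1} ∨
      S = {0, 2} ∨ S = {1, 2} ∨ S = {0, 1, 2} := by decide
  obtain rfl | rfl | rfl | rfl | rfl | rfl | rfl := hcases S hS <;>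
    simpa [← add_assoc]

theorem brahmaguptaCurve_equation {F : Type*} [Field F] [CharZero F] (p q r s : F) (i : Fin 3) :
    (brahmaguptaCurve p q r s).Equation (brahmaguptaX p q r s i) (brahmaguptaY p q r s i) := by
  rw [WeierstrassCurve.Affine.equation_iff]
  fin_cases i <;> simp [brahmaguptaCurve, brahmaguptaX, brahmaguptaY] <;> field_simp <;> ring

/-- The 2-descent, for any `p, q, r, s` that specialize to `1, 1/2, 2, 0`. This covers the generic
curve, with `A` a local ring of `ℚ[p, q, r, s]`, and the specialized one, with `A = K = ℚ`. -/
theorem brahmagupta_of_reduces {A K : Type*} [CommRing A] [IsDomain A] [IsIntegrallyClosed A]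
    [Field K] [CharZero K] [Algebra A K] [IsFractionRing A K] (φ : A →+* ℚ) [IsLocalHom φ]
    {p q r s : K} (hp : Reduces φ p 1) (hq : Reduces φ q (1 / 2)) (hr : Reduces φ r 2)
    (hs : Reduces φ s 0) :
    (brahmaguptaCurve p q r s).IsElliptic ∧ BrahmaguptaPointsIndependent p q r s := by
  classical
  have h₄ : Reduces φ (brahmaguptaCurve p q r s).a₄ 0 := by
    refine Reduces.congr ((Reduces.ofNat φ 3).neg.mul ((((hp.mul hq).mul hr).mul hs).pow 2))
      rfl ?_
    norm_num
  have h₆ : Reduces φ (brahmaguptaCurve p q r s).a₆ (16248705 / 16384) := by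
    refine Reduces.congr (((((Reduces.ofNat φ 2).mul ((((hp.mul hq).mul hr).mul hs).pow 3)).add
      (((Reduces.one φ).div (Reduces.ofNat φ 4) (by norm_num)).mul
        (((((hp.pow 6).add (hs.pow 6)).sub (hq.pow 6)).sub (hr.pow 6)).pow 2))).sub
      ((((hp.pow 3).mul (hs.pow 3)).add ((hq.pow 3).mul (hr.pow 3))).pow 2))) rfl ?_
    norm_num
  have hΔ : (brahmaguptaCurve p q r s).Δ ≠ 0 := by
    have h : (brahmaguptaCurve p q r s).Δ = -(64 * (brahmaguptaCurve p q r s).a₄ ^ 3)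
        - 432 * (brahmaguptaCurve p q r s).a₆ ^ 2 := by
      simp only [WeierstrassCurve.Δ, WeierstrassCurve.b₂, WeierstrassCurve.b₄,
        WeierstrassCurve.b₆, WeierstrassCurve.b₈, brahmaguptaCurve]
      ring
    rw [h]
    exact ((((Reduces.ofNat φ 64).mul (h₄.pow 3)).neg).sub
      ((Reduces.ofNat φ 432).mul (h₆.pow 2))).ne ⟨0, map_zero _, map_zero _⟩ (by norm_num)
  refine ⟨⟨isUnit_iff_ne_zero.mpr hΔ⟩,
    fun i => (WeierstrassCurve.Affine.equation_iff_nonsingular_of_Δ_ne_zero hΔ).mp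
      (brahmaguptaCurve_equation p q r s i), ?_⟩
  set P : Fin 3 → (brahmaguptaCurve p q r s).Point := fun i => .some _ _
    ((WeierstrassCurve.Affine.equation_iff_nonsingular_of_Δ_ne_zero hΔ).mp
      (brahmaguptaCurve_equation p q r s i))
  have hP₀ : PointReduces φ (P 0) (1 / 4) (-4031 / 128) := by
    refine ⟨_, _, _, rfl, ?_, ?_⟩
    · refine Reduces.congr (((hp.pow 2).mul (hq.pow 2)).add ((hr.pow 2).mul (hs.pow 2))) rfl ?_
      norm_num
    · refine Reduces.congr (((((hp.pow 6).add (hq.pow 6)).sub (hr.pow 6)).sub (hs.pow 6)).div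
        (Reduces.ofNat φ 2) (by norm_num)) rfl ?_
      norm_num
  have hP₁ : PointReduces φ (P 1) 4 (4159 / 128) := by
    refine ⟨_, _, _, rfl, ?_, ?_⟩
    · refine Reduces.congr (((hp.pow 2).mul (hr.pow 2)).add ((hq.pow 2).mul (hs.pow 2))) rfl ?_
      norm_num
    · refine Reduces.congr (((((hp.pow 6).sub (hq.pow 6)).add (hr.pow 6)).sub (hs.pow 6)).div
        (Reduces.ofNat φ 2) (by norm_num)) rfl ?_
      norm_num
  have hP₂ : PointReduces φ (P 2) 1 (-4033 / 128) := by
    refine ⟨_, _, _, rfl, ?_, ?_⟩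
    · refine Reduces.congr (((hp.pow 2).mul (hs.pow 2)).add ((hq.pow 2).mul (hr.pow 2))) rfl ?_
      norm_num
    · refine Reduces.congr (((((hp.pow 6).sub (hq.pow 6)).sub (hr.pow 6)).add (hs.pow 6)).div
        (Reduces.ofNat φ 2) (by norm_num)) rfl ?_
      norm_num
  have hP₀₁ : PointReduces φ (P 0 + P 1) (73441 / 256) (-19902929 / 4096) :=
    hP₀.add rfl rfl rfl hP₁ (by norm_num) rfl (by norm_num) (by norm_num)
  have hP₀₂ : PointReduces φ (P 0 + P 2) (-2879 / 2304) (3479329 / 110592) :=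
    hP₀.add rfl rfl rfl hP₂ (by norm_num) rfl (by norm_num) (by norm_num)
  have hP₁₂ : PointReduces φ (P 1 + P 2) (4051 / 9) (-33003173 / 3456) :=
    hP₁.add rfl rfl rfl hP₂ (by norm_num) rfl (by norm_num) (by norm_num)
  have hP₀₁₂ : PointReduces φ (P 0 + P 1 + P 2) (-455861 / 168100) (-34376352533 / 1102736000) :=
    hP₀₁.add rfl rfl rfl hP₂ (by norm_num) rfl (by norm_num) (by norm_num)
  refine linearIndependent_int_of_forall_ne_two_nsmul P (fun Q hQ => ?_)
    (forall_nonempty_sum_fin_three P (p := fun R => ∀ Q, R ≠ 2 • Q) ?_ ?_ ?_ ?_ ?_ ?_ ?_)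
  · by_contra hQ0
    obtain ⟨τ, hτ⟩ := exists_root_of_two_nsmul_eq_zero rfl rfl rfl h₄ h₆ hQ0 hQ
    refine pow_three_ne_of_not_three_dvd 2 (a := -((16248705 : ℕ) / (2 : ℕ) ^ 14)) ?_ τ ?_
    · rw [padicValRat.neg, padicValRat.div (by norm_num) (by norm_num), padicValRat.pow,
        padicValRat.self (by norm_num), padicValRat.of_nat,
        padicValNat.eq_zero_of_not_dvd (by norm_num)]
      norm_num
    · push_cast
      linear_combination hτ
  all_goals intro Q hQ
  -- in each case the integers are the coefficients of the specialized doubling quartic after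
  -- clearing denominators, and the prime is one modulo which that quartic has no root
  · obtain ⟨τ, hτ⟩ := exists_root_of_eq_two_nsmul rfl rfl rfl h₄ h₆ hP₀ hQ
    refine quartic_ne_zero_of_zmod (ℓ := 7) (by norm_num)
      16384 (-16384) 0 (-129989640) (-16248705) (by decide) (by decide) τ ?_
    push_cast
    linear_combination 16384 * hτ
  · obtain ⟨τ, hτ⟩ := exists_root_of_eq_two_nsmul rfl rfl rfl h₄ h₆ hP₁ hQ
    refine quartic_ne_zero_of_zmod (ℓ := 7) (by norm_num)
      2048 (-32768) 0 (-16248705) (-32497410) (by decide) (by decide) τ ?_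
    push_cast
    linear_combination 2048 * hτ
  · obtain ⟨τ, hτ⟩ := exists_root_of_eq_two_nsmul rfl rfl rfl h₄ h₆ hP₂ hQ
    refine quartic_ne_zero_of_zmod (ℓ := 7) (by norm_num)
      4096 (-16384) 0 (-32497410) (-16248705) (by decide) (by decide) τ ?_
    push_cast
    linear_combination 4096 * hτ
  · obtain ⟨τ, hτ⟩ := exists_root_of_eq_two_nsmul rfl rfl rfl h₄ h₆ hP₀₁ hQ
    refine quartic_ne_zero_of_zmod (ℓ := 7) (by norm_num)
      1048576 (-1203257344) 0 (-8319336960) (-1193321143905) (by decide) (by decide) τ ?_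
    push_cast
    linear_combination 1048576 * hτ
  · obtain ⟨τ, hτ⟩ := exists_root_of_eq_two_nsmul rfl rfl rfl h₄ h₆ hP₀₂ hQ
    refine quartic_ne_zero_of_zmod (ℓ := 7) (by norm_num)
      9437184 47169536 0 (-74874032640) 46780021695 (by decide) (by decide) τ ?_
    push_cast
    linear_combination 9437184 * hτ
  · obtain ⟨τ, hτ⟩ := exists_root_of_eq_two_nsmul rfl rfl rfl h₄ h₆ hP₁₂ hQ
    refine quartic_ne_zero_of_zmod (ℓ := 7) (by norm_num)
      36864 (-66371584) 0 (-292476690) (-65823503955) (by decide) (by decide) τ ?_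
    push_cast
    linear_combination 36864 * hτ
  · obtain ⟨τ, hτ⟩ := exists_root_of_eq_two_nsmul rfl rfl rfl h₄ h₆ hP₀₁₂ hQ
    refine quartic_ne_zero_of_zmod (ℓ := 29) (by norm_num)
      688537600 7468826624 0 (-5462814621000) 7407150910005 (by decide) (by decide) τ ?_
    push_cast
    linear_combination 688537600 * hτ

theorem BrahmaguptaPointsIndependent.three_le_mordellWeilRank {F : Type*} [Field F]
    {p q r s : F} (h : BrahmaguptaPointsIndependent p q r s) :
    3 ≤ mordellWeilRank (brahmaguptaCurve p q r s) := by
  classical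
  obtain ⟨_, hli⟩ := h
  simpa [mordellWeilRank] using hli.cardinal_lift_le_rank

/-! ### The generic curve and its specialization -/

/-- The local ring of `ℚ[p, q, r, s]` at `(1, 1/2, 2, 0)` maps to `ℚ` by evaluation. -/
theorem brahmagupta_generic :
    (brahmaguptaCurve (indet 0) (indet 1) (indet 2) (indet 3)).IsElliptic ∧
      BrahmaguptaPointsIndependent (indet 0) (indet 1) (indet 2) (indet 3) := by
  set ev : MvPolynomial (Fin 4) ℚ →+* ℚ := MvPolynomial.eval ![1, 1 / 2, 2, 0]
  have hprime : (RingHom.ker ev).IsPrime := RingHom.ker_isPrime ev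
  set A := Localization.AtPrime (RingHom.ker ev)
  have : IsDomain A := IsLocalization.isDomain_localization
    (RingHom.ker ev).primeCompl_le_nonZeroDivisors
  have : IsIntegrallyClosed A := isIntegrallyClosed_of_isLocalization A
    (RingHom.ker ev).primeCompl (RingHom.ker ev).primeCompl_le_nonZeroDivisors
  have hunit (y : (RingHom.ker ev).primeCompl) : IsUnit (ev y) := isUnit_iff_ne_zero.mpr y.2
  let φ : A →+* ℚ := IsLocalization.lift hunit
  have : IsLocalHom φ := by
    -- a fraction is a unit of `A` as soon as its numerator does not vanish at the chosen point
    refine ⟨fun a ha => ?_⟩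
    obtain ⟨x, y, rfl⟩ := IsLocalization.exists_mk'_eq (RingHom.ker ev).primeCompl a
    rw [IsLocalization.AtPrime.isUnit_mk'_iff A (RingHom.ker ev)]
    intro hx
    rw [IsLocalization.lift_mk'] at ha
    simp [(RingHom.mem_ker).mp hx] at ha
  have hX (i : Fin 4) : Reduces φ (indet i) (![1, 1 / 2, 2, 0] i) := by
    refine ⟨algebraMap (MvPolynomial (Fin 4) ℚ) A (MvPolynomial.X i), ?_, ?_⟩
    · rw [← IsScalarTower.algebraMap_apply, indet]
    · simp [φ, IsLocalization.lift_eq, ev]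
  exact brahmagupta_of_reduces φ (hX 0) (hX 1) (hX 2) (hX 3)

theorem mainTheorem2 :
    -- the generic curve over `ℚ(p, q, r, s)`
    ((brahmaguptaCurve (indet 0) (indet 1) (indet 2) (indet 3)).IsElliptic ∧
      BrahmaguptaPointsIndependent (indet 0) (indet 1) (indet 2) (indet 3) ∧
      3 ≤ mordellWeilRank (brahmaguptaCurve (indet 0) (indet 1) (indet 2) (indet 3))) ∧
    -- the specialization at `(1, 1/2, 2, 0)`
    ((∀ x y : ℚ, (brahmaguptaCurve (1 : ℚ) (1 / 2) 2 0).Equation x y ↔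
        y ^ 2 = x ^ 3 + 16248705 / 16384) ∧
      (brahmaguptaCurve (1 : ℚ) (1 / 2) 2 0).IsElliptic ∧
      BrahmaguptaPointsIndependent (1 : ℚ) (1 / 2) 2 0) := by
  obtain ⟨hell, hind⟩ := brahmagupta_generic
  refine ⟨⟨hell, hind, hind.three_le_mordellWeilRank⟩, fun x y => ?_, ?_⟩
  · rw [WeierstrassCurve.Affine.equation_iff]
    norm_num [brahmaguptaCurve]
  · exact brahmagupta_of_reduces (RingHom.id ℚ) ⟨_, rfl, rfl⟩ ⟨_, rfl, rfl⟩ ⟨_, rfl, rfl⟩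
      ⟨_, rfl, rfl⟩
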